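/- **Setting.** For $F:\mathbb{R}^n\to\mathbb{R}\cup\{+\infty\}$ proper, convex and lower semicontinuous ($F\in\Gamma_0(\mathbb{R}^n)$), let $\partial F$ be its subdifferential, $\operatorname{dom}F=\{F<+\infty\}$, and $T^F_x=\operatorname{par}(\partial F(x))^{\perp}$, where $\operatorname{par}(C)$ is the linear subspace parallel to the affine hull of $C$; $\operatorname{ri}$ is the relative interior. $F$ is *partly smooth at $x$ relative to a set* $\mathcal M\ni x$, written $F\in\mathrm{PSF}_x(\mathcal M)$, if $\partial F(x)\neq\emptyset$ and (1) $\mathcal M$ is a $C^2$ embedded submanifold of $\mathbb{R}^n$ around $x$ and the restriction of $F$ to $\mathcal M$ is $C^2$ around $x$ (on $\mathcal M$ near $x$ it agrees with a real function that is $C^2$ near $x$ in $\mathbb{R}^n$); (2) the tangent space $\mathcal T_{\mathcal M}(x)$ equals $T^F_x$; (3) $\partial F$ is inner and outer semicontinuous (Painlevé–Kuratowski) at $x$ relative to $\mathcal M$. $F$ is *locally polyhedral around $x$* if over some neighbourhood of $x$ its epigraph agrees with a finite intersection of closed half-spaces of $\mathbb{R}^n\times\mathbb{R}$. If $F|_{\mathcal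 M}$ has near $x'\in\mathcal M$ a $C^2$ extension $\widetilde F$, the Riemannian gradient is $\nabla_{\mathcal M}F(x')=\mathrm P_{\mathcal T_{\mathcal M}(x')}\nabla\widetilde F(x')$, and the Riemannian Hessian is the linear map $\nabla^2_{\mathcal M}F(x')h=\mathrm P_{\mathcal T_{\mathcal M}(x')}\,d(\nabla_{\mathcal M}F)(x')[h]$ of $\mathcal T_{\mathcal M}(x')$, with $\mathrm P$ the orthogonal projection. **Proposition (finite activity identification for ADMM).** Let $G\in\Gamma_0(\mathbb{R}^n)$, $J\in\Gamma_0(\mathbb{R}^m)$, let $L:\mathbb{R}^n\to\mathbb{R}^m$ be linear and injective with $\operatorname{ri}\big(\operatorname{dom}G\cap L^{-1}(\operatorname{dom}J)\big)\neq\emptyset$, and let $\gamma>0$. Let $v_0,y_0\in\mathbb{R}^m$ and, for $k\ge 0$, $$u_{k+1}=\operatorname*{argmin}_{u}\,G(u)+\langle Lu,y_k\rangle+\tfrac{\gamma}{2}\|Lu-v_k\|^2,\qquad v_{k+1}=\operatorname*{argmin}_{v}\,J(v)-\langle v,y_k\rangle+\tfrac{\gamma}{2}\|v-Lu_{k+1}\|^2,\qquad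 y_{k+1}=y_k+\gamma(Lu_{k+1}-v_{k+1}).$$ Suppose that $(u_k,v_k,y_k)\to(u^\star,v^\star,y^\star)$, where $u^\star\in\operatorname{Argmin}(G+J\circ L)$ and $v^\star=Lu^\star$, that $G\in\mathrm{PSF}_{u^\star}(\mathcal M^G)$ and $J\in\mathrm{PSF}_{v^\star}(\mathcal M^J)$, and that $$-L^{T}y^\star\in\operatorname{ri}(\partial G(u^\star))\qquad\text{and}\qquad y^\star\in\operatorname{ri}(\partial J(v^\star)).$$ Then there is $K\in\mathbb{N}$ such that the following hold. 1. $(u_k,v_k)\in\mathcal M^G\times\mathcal M^J$ for all $k\ge K$. 2. (a) If $\mathcal M^G$ coincides with $u^\star+T^G_{u^\star}$ in a neighbourhood of $u^\star$, then $T^G_{u_k}=T^G_{u^\star}$ for all $k\ge K$. (b) If $G$ is locally polyhedral around $u^\star$, then $\mathcal M^G$ coincides with $u^\star+T^G_{u^\star}$ in a neighbourhood of $u^\star$, and for all $k\ge K$: $u_k\in\mathcal M^G\cap(u^\star+T^G_{u^\star})$, $T^G_{u_k}=T^G_{u^\star}$, $\nabla_{\mathcal M^G}G(u_k)=\nabla_{\mathcal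 M^G}G(u^\star)$ and $\nabla^2_{\mathcal M^G}G(u_k)=0$ (these gradients and Hessians exist). 3. The statements (a) and (b) hold likewise for $J$, $\mathcal M^J$, $v_k$, $v^\star$ in place of $G$, $\mathcal M^G$, $u_k$, $u^\star$. -/

import Mathlib

open Filter Topology Set
open scoped RealInnerProductSpace

namespace PartlySmooth

/-- The Euclidean space `ℝⁿ`. -/
abbrev Eucl (n : ℕ) := EuclideanSpace ℝ (Fin n)

/-! ### Convex analysis of extended-real-valued functions -/

/-- The effective domain of an extended-real-valued function. -/
def effDomain {n : ℕ} (F : Eucl n → EReal) : Set (Eucl n) := {x | F x ≠ ⊤}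

/-- The class `Γ₀(ℝⁿ)` of proper, convex, lower semicontinuous functions. -/
structure IsGammaZero {n : ℕ} (F : Eucl n → EReal) : Prop where
  ne_bot : ∀ x, F x ≠ ⊥
  domain_nonempty : (effDomain F).Nonempty
  convex_epigraph : Convex ℝ {p : Eucl n × ℝ | F p.1 ≤ (p.2 : EReal)}
  lsc : LowerSemicontinuous F

/-- The subdifferential `∂F(x) = {g | F(z) ≥ F(x) + ⟨g, z - x⟩ for all z}`.
It is empty at points outside the domain of a proper `F`. -/
def subdiff {n : ℕ} (F : Eucl n → EReal) (x : Eucl n) : Set (Eucl n) :=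
  {g | ∀ z, F x + ((⟪g, z - x⟫ : ℝ) : EReal) ≤ F z}

/-- `T_x = par(∂F(x))ᗮ`, where `par C` is the linear subspace parallel to the affine hull
of `C`. -/
noncomputable def tangentOfSubdiff {n : ℕ} (F : Eucl n → EReal) (x : Eucl n) :
    Submodule ℝ (Eucl n) :=
  (vectorSpan ℝ (subdiff F x))ᗮ

/-- `F` is locally polyhedral around `x`: over a neighbourhood of `x`, the epigraph of `F`
agrees with a polyhedron of `ℝⁿ × ℝ` (a finite intersection of closed half-spaces). -/
def IsLocallyPolyhedral {n : ℕ} (F : Eucl n → EReal) (x : Eucl n) : Prop :=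
  ∃ (N : ℕ) (a : Fin N → Eucl n) (b c : Fin N → ℝ),
    ∀ᶠ z in 𝓝 x, ∀ t : ℝ, F z ≤ (t : EReal) ↔ ∀ i, ⟪a i, z⟫ + b i * t ≤ c i

/-- Painlevé–Kuratowski continuity of a set-valued map `S` at `x` relative to the set `M`:
`S` is inner and outer semicontinuous at `x` along points of `M`. -/
structure SetValuedContinuousWithinAt {n : ℕ} (S : Eucl n → Set (Eucl n)) (M : Set (Eucl n))
    (x : Eucl n) : Prop where
  inner_semicont : ∀ g ∈ S x, ∀ ε > 0, ∀ᶠ z in 𝓝[M] x, ∃ g' ∈ S z, dist g' g < ε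
  outer_semicont : ∀ g ∉ S x, ∃ ε > 0, ∀ᶠ z in 𝓝[M] x, ∀ g' ∈ S z, ε ≤ dist g' g

/-! ### Submanifolds of `ℝⁿ` and functions on them -/

/-- `M` is a `C²`-smooth embedded submanifold of `ℝⁿ` around `x`: near `x` it is the zero set
of a `C²` map whose derivative at `x` is surjective. -/
def IsC2ManifoldAround {n : ℕ} (M : Set (Eucl n)) (x : Eucl n) : Prop :=
  ∃ (p : ℕ) (Φ : Eucl n → Eucl p), ContDiffAt ℝ 2 Φ x ∧ Φ x = 0 ∧
    Function.Surjective (fderiv ℝ Φ x) ∧ ∀ᶠ z in 𝓝 x, z ∈ M ↔ Φ z = 0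

/-- The tangent space of `M` at `x`: the velocities at `x` of curves lying in `M`. (For a
submanifold these velocities already form a subspace, and the span changes nothing.) -/
def tangentSpace {n : ℕ} (M : Set (Eucl n)) (x : Eucl n) : Submodule ℝ (Eucl n) :=
  Submodule.span ℝ {h | ∃ c : ℝ → Eucl n, c 0 = x ∧ HasDerivAt c h 0 ∧ ∀ᶠ t in 𝓝 0, c t ∈ M}

/-- `f` is a `C²` representative of `F` on `M` around `x`: a real function, `C²` around `x` in
the ambient space, that agrees with `F` on `M` near `x`. -/
def IsC2Representative {n : ℕ} (M : Set (Eucl n)) (F : Eucl n → EReal) (x : Eucl n)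
    (f : Eucl n → ℝ) : Prop :=
  ContDiffAt ℝ 2 f x ∧ ∀ᶠ z in 𝓝[M] x, F z = (f z : EReal)

/-- `M` is a `C²`-manifold around `x` and the restriction of `F` to `M` is `C²` around `x`. -/
def IsC2Along {n : ℕ} (M : Set (Eucl n)) (F : Eucl n → EReal) (x : Eucl n) : Prop :=
  IsC2ManifoldAround M x ∧ ∃ f, IsC2Representative M F x f

/-- `F ∈ Γ₀(ℝⁿ)` is partly smooth at `x` relative to `M`. -/
structure IsPartlySmoothAt {n : ℕ} (F : Eucl n → EReal) (x : Eucl n) (M : Set (Eucl n)) :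
    Prop where
  gammaZero : IsGammaZero F
  subdiff_nonempty : (subdiff F x).Nonempty
  mem : x ∈ M
  smoothness : IsC2Along M F x
  sharpness : tangentSpace M x = tangentOfSubdiff F x
  continuity : SetValuedContinuousWithinAt (subdiff F) M x

/-- `g` is the Riemannian gradient `∇_M F(x)`: `F` is `C²` along `M` around `x`, and `g` is the
orthogonal projection on the tangent space of the gradient of any `C²` representative. -/
def HasRiemannianGradientAt {n : ℕ} (M : Set (Eucl n)) (F : Eucl n → EReal) (x g : Eucl n) :
    Prop :=
  IsC2Along M F x ∧
    ∀ f, IsC2Representative M F x f → (tangentSpace M x).starProjection (gradient f x) = g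

/-- `H` is the Riemannian Hessian `∇²_M F(x)`, a linear endomorphism of the tangent space:
`H h` is the orthogonal projection on the tangent space at `x` of the derivative, along `M` in
the direction `h`, of the field `z ↦ ∇_M F(z)`. -/
def HasRiemannianHessianAt {n : ℕ} (M : Set (Eucl n)) (F : Eucl n → EReal) (x : Eucl n)
    (H : tangentSpace M x →L[ℝ] tangentSpace M x) : Prop :=
  ∃ (V : Eucl n → Eucl n) (A : Eucl n →L[ℝ] Eucl n),
    IsC2Along M F x ∧
    (∀ᶠ z in 𝓝[M] x, HasRiemannianGradientAt M F z (V z)) ∧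
    HasFDerivWithinAt V A M x ∧
    ∀ h : tangentSpace M x, (H h : Eucl n) = (tangentSpace M x).starProjection (A h)

/-- Near `x`, the set `M` coincides with the affine subspace `x + T`. -/
def CoincidesNearWithAffine {n : ℕ} (M : Set (Eucl n)) (x : Eucl n)
    (T : Submodule ℝ (Eucl n)) : Prop :=
  ∀ᶠ z in 𝓝 x, z ∈ M ↔ z - x ∈ T

/-! ### The alternating direction method of multipliers -/

/-- `(u, v, y)` is generated by ADMM with step-size `γ` for `min G + J ∘ L`, from the initial
`v 0` and `y 0` (the value `u 0` plays no role). -/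
structure IsADMM {n m : ℕ} (G : Eucl n → EReal) (J : Eucl m → EReal) (L : Eucl n →L[ℝ] Eucl m)
    (γ : ℝ) (u : ℕ → Eucl n) (v y : ℕ → Eucl m) : Prop where
  u_step : ∀ k, IsMinOn
    (fun w => G w + ((⟪L w, y k⟫ + γ / 2 * ‖L w - v k‖ ^ 2 : ℝ) : EReal)) univ (u (k + 1))
  v_step : ∀ k, IsMinOn
    (fun w => J w + ((-⟪w, y k⟫ + γ / 2 * ‖w - L (u (k + 1))‖ ^ 2 : ℝ) : EReal)) univ (v (k + 1))
  y_step : ∀ k, y (k + 1) = y k + γ • (L (u (k + 1)) - v (k + 1))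

end PartlySmooth

open PartlySmooth

namespace PartlySmooth

/-! ### Relative interiors and inner semicontinuity -/

/-! The optimality conditions of the two ADMM subproblems place explicit subgradients at `u k` and
`v k`. Since `L u_k - v_{k-1} → 0`, these converge to `-Lᵀy⋆` and `y⋆`, both relative interior
points, so everything reduces to one partly smooth `F` at `x` and `g ∈ ri ∂F(x)`.

Identification (`IsPartlySmoothAt.eventually_mem`): by sharpness the normal space of `M` at `x` is
`N = par ∂F(x)`. Compactness of the unit sphere of `N` and inner semicontinuity give one `ε` such
that, for `z' ∈ M` near `x` and `d ∈ N`, some `g' ∈ ∂F(z')` has `⟪g' - g, d⟫ ≥ ε‖d‖`. Given `h ∈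
∂F(z)`, move `z` to `z' ∈ M` with `d = z - z' ∈ N`. Monotonicity of `∂F` yields `ε‖d‖ ≤ ‖h - g‖‖d‖`,
so `d = 0` once `‖h - g‖ < ε`.

If `M` is affine, smoothness along `M` confines `par ∂F(z)` to `N`, and the same estimate forbids it
to shrink. If `F` is locally polyhedral, its epigraph is a cone near `(x, F x)`, so `∂F(z)` lies in
the face of `∂F(x)` exposed by `z - x`. The estimate in the direction `-P_N(z - x)` then forces `z -
x ∈ Nᗮ` for `z ∈ M`. -/

lemma exists_forall_add_mem_of_mem_intrinsicInterior {n : ℕ} {C : Set (Eucl n)} {g : Eucl n}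
    (hg : g ∈ intrinsicInterior ℝ C) :
    ∃ ε > 0, ∀ d ∈ vectorSpan ℝ C, ‖d‖ < ε → g + d ∈ C := by
  obtain ⟨y, hy, rfl⟩ := mem_intrinsicInterior.1 hg
  obtain ⟨ε, hε, hball⟩ := Metric.mem_nhds_iff.1 (mem_interior_iff_mem_nhds.1 hy)
  refine ⟨ε, hε, fun d hd hdε => ?_⟩
  have hmem : (y : Eucl n) + d ∈ affineSpan ℝ C := by
    have h := AffineSubspace.vadd_mem_of_mem_direction
      (by rwa [direction_affineSpan] : d ∈ (affineSpan ℝ C).direction) y.2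
    rwa [vadd_eq_add, add_comm] at h
  have : (⟨(y : Eucl n) + d, hmem⟩ : affineSpan ℝ C) ∈ Metric.ball y ε := by
    rw [Metric.mem_ball, Subtype.dist_eq]
    simpa [dist_eq_norm] using hdε
  exact hball this

/-- Near a point of inner semicontinuity, the values of a set-valued map stick out of a relative
interior point `g` of `S x` by a uniform amount in every direction of the span of `S x`. -/
lemma exists_eventually_le_inner {n : ℕ} {S : Eucl n → Set (Eucl n)} {M : Set (Eucl n)}
    {x g : Eucl n} (hS : SetValuedContinuousWithinAt S M x)
    (hg : g ∈ intrinsicInterior ℝ (S x)) :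
    ∃ ε > 0, ∀ᶠ z in 𝓝[M] x, ∀ d ∈ vectorSpan ℝ (S x), ∃ g' ∈ S z, ε * ‖d‖ ≤ ⟪g' - g, d⟫ := by
  obtain ⟨ε, hε, hC⟩ := exists_forall_add_mem_of_mem_intrinsicInterior hg
  refine ⟨ε / 4, by positivity, ?_⟩
  have hN : IsClosed (vectorSpan ℝ (S x) : Set (Eucl n)) := Submodule.closed_of_finiteDimensional _
  have hK : IsCompact (Metric.sphere (0 : Eucl n) 1 ∩ (vectorSpan ℝ (S x) : Set (Eucl n))) :=
    (isCompact_sphere 0 1).inter_right hN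
  -- Compactness makes the neighbourhood of `x` independent of `d`. The constant: the target `g +
  -- (ε/2) d` gains `ε/2`, replacing `d` by `d'` within `1/4` keeps at least `3ε/8`, and an error
  -- `ε/8` in `g'` leaves `ε/4`.
  have key : {p : Eucl n × Eucl n | ‖p.2‖ = 1 → ∃ g' ∈ S p.1, ε / 4 ≤ ⟪g' - g, p.2⟫} ∈
      𝓝[M] x ×ˢ 𝓝ˢ (Metric.sphere (0 : Eucl n) 1 ∩ (vectorSpan ℝ (S x) : Set (Eucl n))) := by
    refine hK.mem_prod_nhdsSet_of_forall fun d hd => ?_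
    have hd1 : ‖d‖ = 1 := by simpa using hd.1
    have hmem : g + (ε / 2) • d ∈ S x := by
      refine hC _ (Submodule.smul_mem _ _ hd.2) ?_
      rw [norm_smul, hd1, Real.norm_of_nonneg (by positivity)]
      linarith
    refine mem_of_superset (prod_mem_prod (hS.inner_semicont _ hmem (ε / 8) (by positivity))
      (Metric.ball_mem_nhds d (by norm_num : (0 : ℝ) < 1 / 4))) ?_
    rintro ⟨z, d'⟩ ⟨⟨g', hg', hdist⟩, hd'⟩ hnorm
    refine ⟨g', hg', ?_⟩
    simp only [mem_ball_iff_norm] at hd' hnorm ⊢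
    rw [dist_eq_norm] at hdist
    have h1 : ⟪g' - g, d'⟫ = ε / 2 * (1 + ⟪d, d' - d⟫) + ⟪g' - (g + (ε / 2) • d), d'⟫ := by
      have : ⟪d, d⟫ = 1 := by rw [real_inner_self_eq_norm_sq, hd1]; norm_num
      simp only [inner_sub_left, inner_sub_right, inner_add_left, real_inner_smul_left, this]
      ring
    have h2 := abs_le.1 (abs_real_inner_le_norm d (d' - d))
    have h3 := abs_le.1 (abs_real_inner_le_norm (g' - (g + (ε / 2) • d)) d')
    rw [hd1, one_mul] at h2
    rw [hnorm, mul_one] at h3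
    rw [h1]
    nlinarith [h2.1, h3.1]
  obtain ⟨U, hU, V, hV, hUV⟩ := mem_prod_iff.1 key
  -- The second fact only provides nonemptiness of `S z`, needed for `d = 0`.
  filter_upwards [hU, hS.inner_semicont g (intrinsicInterior_subset hg) 1 one_pos]
    with z hz ⟨w, hw, _⟩ d hd
  rcases eq_or_ne d 0 with rfl | hd0
  · exact ⟨w, hw, by simp⟩
  · have hpos : 0 < ‖d‖ := norm_pos_iff.2 hd0
    have hunit : ‖‖d‖⁻¹ • d‖ = 1 := norm_smul_inv_norm hd0
    obtain ⟨g', hg', hle⟩ := hUV (mk_mem_prod hz (subset_of_mem_nhdsSet hV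
      ⟨by simpa using hunit, Submodule.smul_mem _ _ hd⟩)) hunit
    refine ⟨g', hg', ?_⟩
    rw [real_inner_smul_right, inv_mul_eq_div, le_div_iff₀ hpos] at hle
    exact hle

/-! ### Submanifolds -/

lemma hasDerivAt_comp_eq_zero {n p : ℕ} {Φ : Eucl n → Eucl p} {x h : Eucl n} {c : ℝ → Eucl n}
    (hΦ : DifferentiableAt ℝ Φ x) (hc0 : c 0 = x) (hc : HasDerivAt c h 0)
    (hzero : ∀ᶠ t in 𝓝 0, Φ (c t) = 0) : fderiv ℝ Φ x h = 0 := by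
  subst hc0
  have h1 := hΦ.hasFDerivAt.comp_hasDerivAt (0 : ℝ) hc
  have h2 : (Φ ∘ c) =ᶠ[𝓝 0] fun _ => (0 : Eucl p) := hzero
  exact h1.unique ((hasDerivAt_const (0 : ℝ) (0 : Eucl p)).congr_of_eventuallyEq h2)

/-- A submanifold is a graph over its tangent space: near `x`, every point can be moved to the
submanifold in a direction orthogonal to the tangent space at `x`. -/
lemma IsC2ManifoldAround.exists_projection {n : ℕ} {M : Set (Eucl n)} {x : Eucl n}
    (hM : IsC2ManifoldAround M x) :
    ∃ π : Eucl n → Eucl n, Tendsto π (𝓝 x) (𝓝[M] x) ∧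
      ∀ᶠ z in 𝓝 x, z - π z ∈ (tangentSpace M x)ᗮ := by
  obtain ⟨p, Φ, hΦ, hx, hsurj, hMΦ⟩ := hM
  set K := (fderiv ℝ Φ x).ker with hK
  -- This inclusion suffices: it reverses to `Kᗮ ≤ (tangentSpace M x)ᗮ`.
  have hTK : tangentSpace M x ≤ K := by
    refine Submodule.span_le.2 ?_
    rintro h ⟨c, hc0, hc, hcM⟩
    have hcont : Tendsto c (𝓝 0) (𝓝 x) := hc0 ▸ hc.continuousAt.tendsto
    refine hasDerivAt_comp_eq_zero (hΦ.differentiableAt (by norm_num)) hc0 hc ?_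
    filter_upwards [hcM, hcont.eventually hMΦ] with t h1 h2 using h2.1 h1
  -- The pair (`Φ`, projection on `K`) is a local chart; the moved point is the zero of `Φ` with the
  -- same `K`-component as `z`, so the displacement lies in `Kᗮ`.
  let φ : ImplicitFunctionData ℝ (Eucl n) (Eucl p) K :=
    { leftFun := Φ
      leftDeriv := fderiv ℝ Φ x
      rightFun := K.orthogonalProjectionOnto
      rightDeriv := K.orthogonalProjectionOnto
      pt := x
      hasStrictFDerivAt_leftFun := hΦ.hasStrictFDerivAt (by norm_num)
      hasStrictFDerivAt_rightFun := K.orthogonalProjectionOnto.hasStrictFDerivAt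
      range_leftDeriv := LinearMap.range_eq_top.2 hsurj
      range_rightDeriv := LinearMap.range_eq_top.2 fun y => ⟨y, by simp⟩
      isCompl_ker := by
        rw [Submodule.ker_orthogonalProjectionOnto]
        exact Submodule.isCompl_orthogonal _ }
  have himpl : Tendsto (fun z => φ.implicitFunction (Φ x) (K.orthogonalProjectionOnto z))
      (𝓝 x) (𝓝 x) := by
    have h1 := φ.hasStrictFDerivAt_implicitFunction_fderiv.hasFDerivAt.continuousAt
    have h2 : ContinuousAt (fun z => φ.implicitFunction (Φ x) (K.orthogonalProjectionOnto z)) x :=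
      ContinuousAt.comp (f := fun z => K.orthogonalProjectionOnto z) h1
        K.orthogonalProjectionOnto.continuous.continuousAt
    have h3 := φ.implicitFunction_apply_image.self_of_nhds
    have h4 := h2.tendsto
    change φ.implicitFunction (Φ x) (K.orthogonalProjectionOnto x) = x at h3
    rwa [h3] at h4
  refine ⟨_, tendsto_nhdsWithin_iff.2 ⟨himpl, ?_⟩, ?_⟩
  · filter_upwards [himpl.eventually hMΦ, φ.leftFun_implicitFunction_eq_leftFun] with z h1 h2
    exact h1.2 (h2.trans hx)
  · filter_upwards [φ.rightFun_implicitFunction_eq_rightFun] with z hz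
    refine Submodule.orthogonal_le hTK ?_
    rw [← Submodule.ker_orthogonalProjectionOnto, LinearMap.mem_ker]
    change K.orthogonalProjectionOnto _ = K.orthogonalProjectionOnto z at hz
    change K.orthogonalProjectionOnto _ = 0
    rw [map_sub, sub_eq_zero]
    exact hz.symm

lemma isC2ManifoldAround_of_coincidesNear {n : ℕ} {M : Set (Eucl n)} {x : Eucl n}
    {T : Submodule ℝ (Eucl n)} (hM : CoincidesNearWithAffine M x T) : IsC2ManifoldAround M x := by
  let Λ : Eucl n →L[ℝ] Eucl (Module.finrank ℝ Tᗮ) :=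
    ((stdOrthonormalBasis ℝ Tᗮ).repr.toContinuousLinearEquiv : Tᗮ →L[ℝ] _) ∘L
      Tᗮ.orthogonalProjectionOnto
  have hΛ : ∀ z, Λ z = 0 ↔ z ∈ T := fun z => by
    simp only [Λ, ContinuousLinearMap.comp_apply, ContinuousLinearEquiv.coe_coe,
      LinearIsometryEquiv.coe_toContinuousLinearEquiv, LinearIsometryEquiv.map_eq_zero_iff]
    rw [← ContinuousLinearMap.coe_coe, ← LinearMap.mem_ker]
    exact (by rw [Submodule.ker_orthogonalProjectionOnto, Submodule.orthogonal_orthogonal])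
  have hd : HasFDerivAt (fun z => Λ (z - x)) Λ x :=
    Λ.hasFDerivAt.comp x ((hasFDerivAt_id x).sub_const x)
  refine ⟨_, fun z => Λ (z - x), ?_, by simp, ?_, ?_⟩
  · exact (Λ.contDiff.comp (contDiff_id.sub contDiff_const)).contDiffAt
  · rw [hd.fderiv]
    intro w
    refine ⟨((stdOrthonormalBasis ℝ Tᗮ).repr.symm w : Tᗮ), ?_⟩
    simp [Λ]
  · filter_upwards [hM] with z hz
    rw [hz, hΛ]

lemma CoincidesNearWithAffine.eventually {n : ℕ} {M : Set (Eucl n)} {x : Eucl n}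
    {T : Submodule ℝ (Eucl n)} (hM : CoincidesNearWithAffine M x T) :
    ∀ᶠ z in 𝓝[M] x, CoincidesNearWithAffine M z T := by
  have h1 := hM
  unfold CoincidesNearWithAffine at h1
  rw [← eventually_eventually_nhds] at h1
  filter_upwards [nhdsWithin_le_nhds h1, self_mem_nhdsWithin] with z hz hzM
  have hzT : z - x ∈ T := hz.self_of_nhds.1 hzM
  filter_upwards [hz] with w hw
  rw [hw, ← sub_add_sub_cancel w z x]
  exact T.add_mem_iff_left hzT

lemma CoincidesNearWithAffine.eventually_add_smul_mem {n : ℕ} {M : Set (Eucl n)} {x : Eucl n}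
    {T : Submodule ℝ (Eucl n)} (hM : CoincidesNearWithAffine M x T) {h : Eucl n} (hh : h ∈ T) :
    ∀ᶠ t : ℝ in 𝓝 0, x + t • h ∈ M := by
  have hcont : Tendsto (fun t : ℝ => x + t • h) (𝓝 0) (𝓝 x) := by
    have : Continuous fun t : ℝ => x + t • h := by fun_prop
    simpa using this.tendsto 0
  filter_upwards [hcont.eventually hM] with t ht
  exact ht.2 (by simpa using T.smul_mem t hh)

lemma CoincidesNearWithAffine.tangentSpace_eq {n : ℕ} {M : Set (Eucl n)} {x : Eucl n}
    {T : Submodule ℝ (Eucl n)} (hM : CoincidesNearWithAffine M x T) : tangentSpace M x = T := by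
  apply le_antisymm
  · refine Submodule.span_le.2 ?_
    rintro h ⟨c, hc0, hc, hcM⟩
    have hcont : Tendsto c (𝓝 0) (𝓝 x) := hc0 ▸ hc.continuousAt.tendsto
    have h1 := Tᗮ.starProjection.hasFDerivAt.comp_hasDerivAt (0 : ℝ) (hc.sub_const x)
    have h2 : (Tᗮ.starProjection ∘ fun t => c t - x) =ᶠ[𝓝 0] fun _ => (0 : Eucl n) := by
      filter_upwards [hcM, hcont.eventually hM] with t h3 h4
      rw [Function.comp_apply, Submodule.starProjection_apply_eq_zero_iff,
        Submodule.orthogonal_orthogonal]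
      exact h4.1 h3
    have h5 := h1.unique ((hasDerivAt_const (0 : ℝ) (0 : Eucl n)).congr_of_eventuallyEq h2)
    rwa [Submodule.starProjection_apply_eq_zero_iff, Submodule.orthogonal_orthogonal] at h5
  · intro h hh
    refine Submodule.subset_span ⟨fun t => x + t • h, by simp, ?_,
      hM.eventually_add_smul_mem hh⟩
    simpa using ((hasDerivAt_id (0 : ℝ)).smul_const h).const_add x

/-! ### Subgradients -/

variable {n : ℕ} {F : Eucl n → EReal} {x z g h : Eucl n} {M : Set (Eucl n)}

lemma IsGammaZero.exists_coe_eq_of_ne_top (hF : IsGammaZero F) (hx : F x ≠ ⊤) :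
    ∃ a : ℝ, F x = a :=
  ⟨(F x).toReal, (EReal.coe_toReal hx (hF.ne_bot x)).symm⟩

lemma IsGammaZero.ne_top_of_mem_subdiff (hF : IsGammaZero F) (hg : g ∈ subdiff F x) :
    F x ≠ ⊤ := by
  intro hx
  obtain ⟨w, hw⟩ := hF.domain_nonempty
  have := hg w
  rw [hx, EReal.top_add_coe] at this
  exact hw (top_le_iff.1 this)

lemma IsGammaZero.exists_coe_eq (hF : IsGammaZero F) (hg : g ∈ subdiff F x) :
    ∃ a : ℝ, F x = a :=
  hF.exists_coe_eq_of_ne_top (hF.ne_top_of_mem_subdiff hg)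

lemma add_inner_le_of_mem_subdiff {a b : ℝ} (hg : g ∈ subdiff F x) (hx : F x = a)
    (hz : F z ≤ b) : a + ⟪g, z - x⟫ ≤ b := by
  have := (hg z).trans hz
  rw [hx] at this
  exact_mod_cast this

lemma IsGammaZero.inner_sub_nonneg (hF : IsGammaZero F) (hg : g ∈ subdiff F x)
    (hh : h ∈ subdiff F z) : 0 ≤ ⟪g - h, x - z⟫ := by
  obtain ⟨a, ha⟩ := hF.exists_coe_eq hg
  obtain ⟨b, hb⟩ := hF.exists_coe_eq hh
  have h1 := add_inner_le_of_mem_subdiff hg ha hb.le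
  have h2 := add_inner_le_of_mem_subdiff hh hb ha.le
  simp only [inner_sub_left, inner_sub_right] at *
  linarith

/-- If `x` minimizes `F + φ`, where `φ` is quadratic with gradient `q` at `x`, then
`-q ∈ ∂F(x)`. -/
lemma IsGammaZero.neg_mem_subdiff_of_isMinOn (hF : IsGammaZero F) {φ c : Eucl n → ℝ} {q : Eucl n}
    (hmin : IsMinOn (fun w => F w + (φ w : EReal)) univ x)
    (hφ : ∀ (d : Eucl n) (t : ℝ), φ (x + t • d) = φ x + t * ⟪q, d⟫ + t ^ 2 * c d) :
    -q ∈ subdiff F x := by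
  have hmin' : ∀ w, F x + (φ x : EReal) ≤ F w + (φ w : EReal) := fun w => hmin (mem_univ w)
  have hxtop : F x ≠ ⊤ := by
    intro hx
    obtain ⟨w, hw⟩ := hF.domain_nonempty
    obtain ⟨b, hb⟩ := hF.exists_coe_eq_of_ne_top hw
    have := hmin' w
    rw [hx, hb, EReal.top_add_coe, ← EReal.coe_add] at this
    exact EReal.coe_ne_top _ (top_le_iff.1 this)
  obtain ⟨a, ha⟩ := hF.exists_coe_eq_of_ne_top hxtop
  intro w
  by_cases hw : F w = ⊤
  · rw [hw]; exact le_top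
  obtain ⟨b, hb⟩ := hF.exists_coe_eq_of_ne_top hw
  -- Compare `x` with the point at parameter `t` on the segment to `w`, use convexity and divide by
  -- `t`; the quadratic term vanishes as `t → 0`.
  have key : ∀ t : ℝ, 0 < t → t < 1 → 0 ≤ (b - a + ⟪q, w - x⟫) + t * c (w - x) := by
    intro t ht0 ht1
    have hconv := hF.convex_epigraph (show (x, a) ∈ _ from ha.le) (show (w, b) ∈ _ from hb.le)
      (by linarith : (0 : ℝ) ≤ 1 - t) ht0.le (by ring)
    have hpt : (1 - t) • x + t • w = x + t • (w - x) := by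
      rw [sub_smul, one_smul, smul_sub]; abel
    simp only [Prod.smul_mk, Prod.mk_add_mk, mem_ofPred_eq, smul_eq_mul, hpt] at hconv
    have h1 := (hmin' (x + t • (w - x))).trans (add_le_add_left hconv _)
    rw [ha, hφ] at h1
    have h2 : a + φ x ≤ ((1 - t) * a + t * b) +
      (φ x + t * ⟪q, w - x⟫ + t ^ 2 * c (w - x)) := by exact_mod_cast h1
    have h3 : 0 ≤ t * ((b - a + ⟪q, w - x⟫) + t * c (w - x)) := by nlinarith
    exact nonneg_of_mul_nonneg_right h3 ht0
  have hlim : Tendsto (fun t : ℝ => (b - a + ⟪q, w - x⟫) + t * c (w - x)) (𝓝[>] 0)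
      (𝓝 (b - a + ⟪q, w - x⟫)) := by
    have : Continuous fun t : ℝ => (b - a + ⟪q, w - x⟫) + t * c (w - x) := by fun_prop
    simpa using (this.tendsto 0).mono_left nhdsWithin_le_nhds
  have hge : 0 ≤ b - a + ⟪q, w - x⟫ := by
    refine ge_of_tendsto hlim ?_
    filter_upwards [Ioo_mem_nhdsGT (zero_lt_one' ℝ)] with t ht using key t ht.1 ht.2
  rw [ha, hb, inner_neg_left]
  exact_mod_cast (by linarith : a + -⟪q, w - x⟫ ≤ b)

/-! ### Partly smooth functions -/

lemma IsPartlySmoothAt.orthogonal_tangentSpace (hM : IsPartlySmoothAt F x M) :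
    (tangentSpace M x)ᗮ = vectorSpan ℝ (subdiff F x) := by
  rw [hM.sharpness, tangentOfSubdiff, Submodule.orthogonal_orthogonal]

/-- Finite identification: if `h ∈ ∂F(z)` with `(z, h)` close to `(x, g)`, where
`g ∈ ri ∂F(x)`, then `z` lies in the active manifold. -/
theorem IsPartlySmoothAt.eventually_mem (hM : IsPartlySmoothAt F x M)
    (hg : g ∈ intrinsicInterior ℝ (subdiff F x)) :
    ∀ᶠ p : Eucl n × Eucl n in 𝓝 (x, g), p.2 ∈ subdiff F p.1 → p.1 ∈ M := by
  obtain ⟨ε, hε, hS⟩ := exists_eventually_le_inner hM.continuity hg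
  obtain ⟨π, hπ, hperp⟩ := hM.smoothness.1.exists_projection
  rw [nhds_prod_eq]
  have h1 : ∀ᶠ p : Eucl n × Eucl n in 𝓝 x ×ˢ 𝓝 g, p.2 ∈ Metric.ball g ε :=
    Eventually.prod_inr (Metric.ball_mem_nhds g hε) (𝓝 x)
  filter_upwards [h1, (hperp.prod_inl (𝓝 g)), (hπ.eventually hS).prod_inl (𝓝 g),
    (hπ.eventually self_mem_nhdsWithin).prod_inl (𝓝 g)]
  rintro ⟨z, h⟩ hh hz hSz hπz hsub
  simp only [mem_ball_iff_norm] at hh hz hSz hπz hsub ⊢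
  rw [hM.orthogonal_tangentSpace] at hz
  obtain ⟨g', hg', hle⟩ := hSz _ hz
  have hmono := hM.gammaZero.inner_sub_nonneg hsub hg'
  have hcs := real_inner_le_norm (h - g) (z - π z)
  have hle' : ε * ‖z - π z‖ ≤ ‖h - g‖ * ‖z - π z‖ := by
    have : ⟪h - g', z - π z⟫ = ⟪h - g, z - π z⟫ - ⟪g' - g, z - π z⟫ := by
      rw [← inner_sub_left]; congr 1; abel
    linarith
  have hzero : ‖z - π z‖ = 0 := by
    by_contra hne
    have hpos : 0 < ‖z - π z‖ := lt_of_le_of_ne (norm_nonneg _) (Ne.symm hne)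
    exact absurd (le_of_mul_le_mul_right hle' hpos) (not_le.2 hh)
  rw [sub_eq_zero.1 (norm_eq_zero.1 hzero)]
  exact hπz

/-- Along directions in which `F` is smooth, the subgradients agree with the gradient of a
smooth representative. -/
lemma IsC2Representative.inner_gradient_eq {f : Eucl n → ℝ}
    (hf : IsC2Representative M F x f) (hx : x ∈ M) (hg : g ∈ subdiff F x)
    (hh : ∀ᶠ t : ℝ in 𝓝 0, x + t • h ∈ M) : ⟪gradient f x, h⟫ = ⟪g, h⟫ := by
  have hfx : F x = f x := hf.2.self_of_nhdsWithin hx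
  have hcont : Tendsto (fun t : ℝ => x + t • h) (𝓝 0) (𝓝[M] x) := by
    refine tendsto_nhdsWithin_iff.2 ⟨?_, hh⟩
    have : Continuous fun t : ℝ => x + t • h := by fun_prop
    simpa using this.tendsto 0
  have hdiff : DifferentiableAt ℝ f x := hf.1.differentiableAt (by norm_num)
  have hline : HasDerivAt (fun t : ℝ => x + t • h) h 0 := by
    simpa using ((hasDerivAt_id (0 : ℝ)).smul_const h).const_add x
  -- By the subgradient inequality this function has a local minimum at `0`, two-sided because the
  -- line stays in `M`.
  have hder : HasDerivAt (fun t : ℝ => f (x + t • h) - t * ⟪g, h⟫)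
      (⟪gradient f x, h⟫ - ⟪g, h⟫) 0 := by
    have h1 : HasFDerivAt f (fderiv ℝ f x) (x + (0 : ℝ) • h) := by simpa using hdiff.hasFDerivAt
    have h2 := h1.comp_hasDerivAt (0 : ℝ) hline
    have h3 : fderiv ℝ f x h = ⟪gradient f x, h⟫ := by
      rw [gradient, InnerProductSpace.toDual_symm_apply]
    rw [h3] at h2
    have h4 := (hasDerivAt_id (0 : ℝ)).mul_const ⟪g, h⟫
    rw [one_mul] at h4
    exact h2.sub h4
  have hmin : IsLocalMin (fun t : ℝ => f (x + t • h) - t * ⟪g, h⟫) 0 := by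
    filter_upwards [hcont.eventually hf.2] with t ht
    have := add_inner_le_of_mem_subdiff hg hfx ht.le
    rw [add_sub_cancel_left, real_inner_smul_right] at this
    simp only [zero_smul, add_zero, zero_mul, sub_zero]
    linarith
  exact sub_eq_zero.1 (hmin.hasDerivAt_eq_zero hder)

/-- If the active manifold is affine, then `T_z` does not depend on `z` in it near `x`. -/
theorem IsPartlySmoothAt.eventually_tangentOfSubdiff_eq (hM : IsPartlySmoothAt F x M)
    (hg : g ∈ intrinsicInterior ℝ (subdiff F x))
    (haff : CoincidesNearWithAffine M x (tangentOfSubdiff F x)) :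
    ∀ᶠ z in 𝓝[M] x, tangentOfSubdiff F z = tangentOfSubdiff F x := by
  obtain ⟨ε, hε, hS⟩ := exists_eventually_le_inner hM.continuity hg
  obtain ⟨f, hf⟩ := hM.smoothness.2
  have hfz : ∀ᶠ z in 𝓝[M] x, IsC2Representative M F z f :=
    Eventually.and (nhdsWithin_le_nhds (hf.1.eventually (by norm_num)))
      (eventually_eventually_nhdsWithin.2 hf.2)
  filter_upwards [hS, hfz, haff.eventually, self_mem_nhdsWithin] with z hSz hfz haffz hzM
  -- All subgradients at `z` have the same component along the tangent directions, namely that of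
  -- `gradient f z`.
  have hle : vectorSpan ℝ (subdiff F z) ≤ vectorSpan ℝ (subdiff F x) := by
    rw [← Submodule.orthogonal_orthogonal (vectorSpan ℝ (subdiff F x))]
    refine Submodule.span_le.2 ?_
    rintro _ ⟨g₁, hg₁, g₂, hg₂, rfl⟩
    refine (Submodule.mem_orthogonal' _ _).2 fun t ht => ?_
    have hcurve := haffz.eventually_add_smul_mem ht
    change ⟪g₁ - g₂, t⟫ = 0
    rw [inner_sub_left, sub_eq_zero,
      ← hfz.inner_gradient_eq hzM hg₁ hcurve,
      ← hfz.inner_gradient_eq hzM hg₂ hcurve]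
  -- If `d` is orthogonal to `par ∂F(z)`, all subgradients at `z` agree on `d`, which contradicts
  -- the estimates for `d` and `-d` unless `d = 0`.
  have hinf : (vectorSpan ℝ (subdiff F z))ᗮ ⊓ vectorSpan ℝ (subdiff F x) = ⊥ := by
    refine (Submodule.eq_bot_iff _).2 fun d ⟨hd1, hd2⟩ => ?_
    obtain ⟨g₁, hg₁, h₁⟩ := hSz d hd2
    obtain ⟨g₂, hg₂, h₂⟩ := hSz (-d) (neg_mem hd2)
    have h₃ : ⟪g₁ - g₂, d⟫ = 0 :=
      (Submodule.mem_orthogonal _ _).1 hd1 _ (vsub_mem_vectorSpan ℝ hg₁ hg₂)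
    rw [norm_neg, inner_neg_right] at h₂
    have h₄ : ⟪g₁ - g₂, d⟫ = ⟪g₁ - g, d⟫ - ⟪g₂ - g, d⟫ := by
      rw [← inner_sub_left]; congr 1; abel
    have h₅ : ε * ‖d‖ ≤ 0 := by linarith
    exact norm_le_zero_iff.1 (nonpos_of_mul_nonpos_right h₅ hε)
  have hsup := Submodule.sup_orthogonal_inf_of_hasOrthogonalProjection hle
  rw [hinf, sup_bot_eq] at hsup
  rw [tangentOfSubdiff, tangentOfSubdiff, hsup]

/-! ### Locally polyhedral functions -/

/-- Near `x`, the epigraph of a locally polyhedral function is a cone with apex `(x, F x)`; in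
particular it is stable under doubling. -/
lemma IsLocallyPolyhedral.eventually_le_two_smul (hF : IsGammaZero F)
    (hpoly : IsLocallyPolyhedral F x) {a : ℝ} (hx : F x = a) :
    ∀ᶠ z in 𝓝 x, ∀ τ : ℝ, F z ≤ ((a + τ : ℝ) : EReal) →
      F (x + (2 : ℝ) • (z - x)) ≤ ((a + 2 * τ : ℝ) : EReal) := by
  obtain ⟨N, A, b, c, hP⟩ := hpoly
  have hx0 : ∀ i, ∀ t : ℝ, a ≤ t → ⟪A i, x⟫ + b i * t ≤ c i := fun i t ht =>
    (hP.self_of_nhds t).1 (by rw [hx]; exact_mod_cast ht) i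
  -- The epigraph is unbounded upwards over `x`.
  have hb : ∀ i, b i ≤ 0 := by
    intro i
    by_contra! hpos
    have h1 := hx0 i a le_rfl
    have h2 := hx0 i (a + (c i - ⟪A i, x⟫ - b i * a + 1) / b i)
      (by have : 0 ≤ (c i - ⟪A i, x⟫ - b i * a + 1) / b i := div_nonneg (by linarith) hpos.le
          linarith)
    rw [mul_add, mul_div_cancel₀ _ hpos.ne'] at h2
    linarith
  have hdouble : Tendsto (fun z : Eucl n => x + (2 : ℝ) • (z - x)) (𝓝 x) (𝓝 x) := by
    have : Continuous fun z : Eucl n => x + (2 : ℝ) • (z - x) := by fun_prop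
    simpa using this.tendsto x
  have hmain : ∀ i, ∀ᶠ z in 𝓝 x, ∀ τ : ℝ, F z ≤ ((a + τ : ℝ) : EReal) →
      ⟪A i, z⟫ + b i * (a + τ) ≤ c i →
      ⟪A i, x + (2 : ℝ) • (z - x)⟫ + b i * (a + 2 * τ) ≤ c i := by
    intro i
    have hexp : ∀ z, ⟪A i, x + (2 : ℝ) • (z - x)⟫ = ⟪A i, x⟫ + 2 * (⟪A i, z⟫ - ⟪A i, x⟫) :=
      fun z => by rw [inner_add_right, real_inner_smul_right, inner_sub_right]
    -- A constraint tight at `(x, a)` is homogeneous in the displacement, so doubling preserves it;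
    -- a slack one survives any small displacement, and lower semicontinuity bounds `τ` below.
    rcases (hx0 i a le_rfl).eq_or_lt with hact | hinact
    · refine Eventually.of_forall fun z τ _ hz => ?_
      rw [hexp]
      linarith
    · obtain ⟨σ, hσ⟩ : ∃ σ, σ = c i - (⟪A i, x⟫ + b i * a) := ⟨_, rfl⟩
      have hσ0 : 0 < σ := by linarith
      have hden : 0 < 1 - b i := by linarith [hb i]
      -- With `τ > -δ` and `b i ≤ 0`, the terms `⟪A i, z - x⟫` and `b i * τ` are each at most `σ /
      -- 4`, so doubled they fit in the slack `σ`. The `1` in `1 - b i` covers `b i = 0`.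
      obtain ⟨δ, hδ⟩ : ∃ δ, δ = σ / (4 * (1 - b i)) := ⟨_, rfl⟩
      have hδ0 : 0 < δ := hδ ▸ by positivity
      have hδσ : δ * (1 - b i) = σ / 4 := by rw [hδ]; field_simp
      have hlsc := hF.lsc x ((a - δ : ℝ) : EReal)
        (show ((a - δ : ℝ) : EReal) < F x by
          rw [hx]; exact_mod_cast (by linarith : a - δ < a))
      have hcont : ∀ᶠ z in 𝓝 x, ⟪A i, z⟫ < ⟪A i, x⟫ + σ / 4 := by
        have hc : Continuous fun z : Eucl n => ⟪A i, z⟫ := by fun_prop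
        exact hc.continuousAt.eventually_lt continuousAt_const (by linarith)
      filter_upwards [hlsc, hcont] with z h1 h2 τ h3 _
      have h4 : a - δ < a + τ := by exact_mod_cast h1.trans_le h3
      rw [hexp]
      nlinarith [hb i]
  filter_upwards [hP, hdouble.eventually hP, eventually_all.2 hmain] with z h1 h2 h3 τ h4
  exact (h2 _).2 fun i => h3 i τ h4 ((h1 _).1 h4 i)

/-- For a locally polyhedral function, the subdifferentials at points `z` near `x` are faces of
the subdifferential at `x`, exposed by the direction `z - x`. -/
lemma IsLocallyPolyhedral.eventually_subdiff_subset (hF : IsGammaZero F)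
    (hpoly : IsLocallyPolyhedral F x) (hx : F x ≠ ⊤) :
    ∀ᶠ z in 𝓝 x, ∀ h ∈ subdiff F z, h ∈ subdiff F x ∧
      ∀ g ∈ subdiff F x, ⟪g, z - x⟫ ≤ ⟪h, z - x⟫ := by
  obtain ⟨a, ha⟩ := hF.exists_coe_eq_of_ne_top hx
  filter_upwards [hpoly.eventually_le_two_smul hF ha] with z hz h hh
  obtain ⟨r, hr⟩ := hF.exists_coe_eq hh
  -- Testing `h` at the doubled point and at `x` gives opposite inequalities, hence `F z = F x + ⟪h,
  -- z - x⟫`.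
  have h1 := add_inner_le_of_mem_subdiff hh hr (hz (r - a) (by rw [hr, add_sub_cancel]))
  have h2 := add_inner_le_of_mem_subdiff hh hr ha.le
  have hsub : x + (2 : ℝ) • (z - x) - z = z - x := by rw [two_smul]; abel
  rw [hsub] at h1
  have h3 : ⟪h, x - z⟫ = -⟪h, z - x⟫ := by rw [← inner_neg_right, neg_sub]
  have h4 : r = a + ⟪h, z - x⟫ := by linarith
  constructor
  · intro w
    have h5 := hh w
    have h6 : ⟪h, w - x⟫ = ⟪h, z - x⟫ + ⟪h, w - z⟫ := by
      rw [← inner_add_right]; congr 1; abel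
    rw [hr, h4, ← EReal.coe_add, add_assoc, ← h6, EReal.coe_add] at h5
    rwa [ha]
  · intro g hg
    have := add_inner_le_of_mem_subdiff hg ha hr.le
    linarith

/-- The active manifold of a locally polyhedral function is affine. -/
theorem IsPartlySmoothAt.coincidesNearWithAffine (hM : IsPartlySmoothAt F x M)
    (hpoly : IsLocallyPolyhedral F x) (hg : g ∈ intrinsicInterior ℝ (subdiff F x)) :
    CoincidesNearWithAffine M x (tangentOfSubdiff F x) := by
  have hgx := intrinsicInterior_subset hg
  obtain ⟨ε, hε, hS⟩ := exists_eventually_le_inner hM.continuity hg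
  have hface := hpoly.eventually_subdiff_subset hM.gammaZero
    (hM.gammaZero.ne_top_of_mem_subdiff hgx)
  have hsub : ∀ᶠ z in 𝓝[M] x, z - x ∈ tangentOfSubdiff F x := by
    filter_upwards [hS, nhdsWithin_le_nhds hface] with z hSz hz
    set N := vectorSpan ℝ (subdiff F x) with hN
    -- This `g'` beats `g` in the direction `-P_N(z - x)`, while the face property says `⟪g' - g, z
    -- - x⟫ ≥ 0`.
    obtain ⟨g', hg', hle⟩ := hSz (-N.starProjection (z - x))
      (neg_mem (N.starProjection_apply_mem _))
    obtain ⟨hg'x, hmax⟩ := hz g' hg'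
    have hmem : g' - g ∈ N := vsub_mem_vectorSpan ℝ hg'x hgx
    have h1 : ⟪g' - g, N.starProjection (z - x)⟫ = ⟪g' - g, z - x⟫ := by
      rw [← Submodule.inner_starProjection_left_eq_right,
        Submodule.starProjection_eq_self_iff.2 hmem]
    have h2 := hmax g hgx
    rw [norm_neg, inner_neg_right, h1, inner_sub_left] at hle
    have h3 : ε * ‖N.starProjection (z - x)‖ ≤ 0 := by linarith
    have h4 := norm_le_zero_iff.1 (nonpos_of_mul_nonpos_right h3 hε)
    exact (Submodule.starProjection_apply_eq_zero_iff N).1 h4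
  obtain ⟨π, hπ, hperp⟩ := hM.smoothness.1.exists_projection
  filter_upwards [eventually_nhdsWithin_iff.1 hsub, hperp, hπ.eventually hsub,
    hπ.eventually self_mem_nhdsWithin] with z h1 h2 h3 h4
  refine ⟨h1, fun h5 => ?_⟩
  -- For `z` in `x + T`, the displacement `z - π z` is both tangent and normal, hence zero.
  have h6 : z - π z ∈ tangentSpace M x := by
    rw [hM.sharpness, ← sub_sub_sub_cancel_right z (π z) x]
    exact sub_mem h5 h3
  have h7 : z - π z = 0 := by
    rw [← inner_self_eq_zero (𝕜 := ℝ)]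
    exact (Submodule.mem_orthogonal _ _).1 h2 _ h6
  rwa [sub_eq_zero.1 h7]

/-- The Riemannian gradient of a locally polyhedral partly smooth function is locally constant
along the active manifold. -/
theorem IsPartlySmoothAt.eventually_hasRiemannianGradientAt (hM : IsPartlySmoothAt F x M)
    (hpoly : IsLocallyPolyhedral F x) (hg : g ∈ intrinsicInterior ℝ (subdiff F x)) :
    ∀ᶠ z in 𝓝[M] x,
      HasRiemannianGradientAt M F z ((tangentOfSubdiff F x).starProjection g) := by
  have hgx := intrinsicInterior_subset hg
  have haff := hM.coincidesNearWithAffine hpoly hg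
  have hface := hpoly.eventually_subdiff_subset hM.gammaZero
    (hM.gammaZero.ne_top_of_mem_subdiff hgx)
  obtain ⟨f, hf⟩ := hM.smoothness.2
  have hfz : ∀ᶠ z in 𝓝[M] x, IsC2Representative M F z f :=
    Eventually.and (nhdsWithin_le_nhds (hf.1.eventually (by norm_num)))
      (eventually_eventually_nhdsWithin.2 hf.2)
  filter_upwards [hfz, haff.eventually, nhdsWithin_le_nhds hface, self_mem_nhdsWithin,
    hM.continuity.inner_semicont g hgx 1 one_pos] with z hfz haffz hz hzM ⟨g', hg', _⟩
  refine ⟨⟨isC2ManifoldAround_of_coincidesNear haffz, f, hfz⟩, fun f' hf' => ?_⟩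
  simp only [haffz.tangentSpace_eq]
  set T := tangentOfSubdiff F x with hT
  rw [← sub_eq_zero, ← map_sub, Submodule.starProjection_apply_eq_zero_iff,
    Submodule.mem_orthogonal']
  intro t ht
  -- On `T` the gradient equals `g'`, and `g'` equals `g` there because both belong to `∂F(x)`.
  have h1 := hf'.inner_gradient_eq hzM hg' (haffz.eventually_add_smul_mem ht)
  have h2 : ⟪g' - g, t⟫ = 0 :=
    (Submodule.mem_orthogonal _ _).1 ht _ (vsub_mem_vectorSpan ℝ (hz g' hg').1 hgx)
  rw [inner_sub_left] at h2 ⊢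
  linarith

lemma hasRiemannianHessianAt_zero (hz : z ∈ M)
    (hgrad : ∀ᶠ w in 𝓝[M] z, HasRiemannianGradientAt M F w g) :
    HasRiemannianHessianAt M F z 0 :=
  ⟨fun _ => g, 0, (hgrad.self_of_nhdsWithin hz).1, hgrad, hasFDerivWithinAt_const g z M,
    fun h => by simp⟩

/-! ### Finite activity identification -/

/-- Finite identification along a sequence: if `x k → x` and there are subgradients at `x k`
converging to a relative interior point of `∂F(x)`, then `x k` eventually lies in the active
manifold. -/
theorem IsPartlySmoothAt.eventually_mem_of_tendsto (hM : IsPartlySmoothAt F x M)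
    (hg : g ∈ intrinsicInterior ℝ (subdiff F x)) {xs gs : ℕ → Eucl n}
    (hxs : Tendsto xs atTop (𝓝 x)) (hgs : Tendsto gs atTop (𝓝 g))
    (hsub : ∀ᶠ k in atTop, gs k ∈ subdiff F (xs k)) : Tendsto xs atTop (𝓝[M] x) := by
  refine tendsto_nhdsWithin_iff.2 ⟨hxs, ?_⟩
  filter_upwards [(hxs.prodMk_nhds hgs).eventually (hM.eventually_mem hg), hsub] with k h1 h2
    using h1 h2

/-- Along a sequence in the active manifold converging to `x`, a locally polyhedral function has
constant tangent spaces and Riemannian gradients, and vanishing Riemannian Hessians. -/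
theorem IsPartlySmoothAt.eventually_of_isLocallyPolyhedral (hM : IsPartlySmoothAt F x M)
    (hpoly : IsLocallyPolyhedral F x) (hg : g ∈ intrinsicInterior ℝ (subdiff F x)) :
    ∀ᶠ z in 𝓝[M] x, z ∈ M ∧ z - x ∈ tangentOfSubdiff F x ∧
      tangentOfSubdiff F z = tangentOfSubdiff F x ∧
      HasRiemannianGradientAt M F z ((tangentOfSubdiff F x).starProjection g) ∧
      HasRiemannianHessianAt M F z 0 := by
  have haff := hM.coincidesNearWithAffine hpoly hg
  have hgrad := hM.eventually_hasRiemannianGradientAt hpoly hg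
  filter_upwards [self_mem_nhdsWithin, nhdsWithin_le_nhds haff,
    hM.eventually_tangentOfSubdiff_eq hg haff, hgrad,
    eventually_eventually_nhdsWithin.2 hgrad] with z h1 h2 h3 h4 h5
  exact ⟨h1, h2.1 h1, h3, h4, hasRiemannianHessianAt_zero h1 h5⟩

/-! ### Optimality conditions for ADMM -/

section ADMM

variable {m : ℕ} {G : Eucl n → EReal} {J : Eucl m → EReal} {L : Eucl n →L[ℝ] Eucl m} {γ : ℝ}
  {u : ℕ → Eucl n} {v y : ℕ → Eucl m}

/-- Fermat's rule for the `u`-step. The old `v k` appears, so this multiplier is in general not `y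
(k + 1)`. -/
lemma IsADMM.neg_adjoint_mem_subdiff (h : IsADMM G J L γ u v y) (hG : IsGammaZero G) (k : ℕ) :
    -(ContinuousLinearMap.adjoint L (y k + γ • (L (u (k + 1)) - v k))) ∈
      subdiff G (u (k + 1)) := by
  refine hG.neg_mem_subdiff_of_isMinOn (c := fun d => γ / 2 * ‖L d‖ ^ 2) (h.u_step k) ?_
  intro d t
  have h1 : L (u (k + 1) + t • d) - v k = (L (u (k + 1)) - v k) + t • L d := by
    rw [map_add, map_smul]; abel
  rw [h1, norm_add_sq_real, ContinuousLinearMap.adjoint_inner_left, norm_smul, mul_pow,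
    Real.norm_eq_abs, sq_abs, map_add, map_smul, inner_add_left, inner_add_left,
    real_inner_smul_left, real_inner_smul_left, real_inner_smul_right,
    real_inner_comm (y k) (L d)]
  ring

/-- Fermat's rule for the `v`-step: the gradient of the quadratic part is exactly `-y (k + 1)` by
the multiplier update. -/
lemma IsADMM.mem_subdiff (h : IsADMM G J L γ u v y) (hJ : IsGammaZero J) (k : ℕ) :
    y (k + 1) ∈ subdiff J (v (k + 1)) := by
  have key := hJ.neg_mem_subdiff_of_isMinOn (q := -y (k + 1)) (c := fun d => γ / 2 * ‖d‖ ^ 2)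
    (h.v_step k) ?_
  · rwa [neg_neg] at key
  intro d t
  have h1 : v (k + 1) + t • d - L (u (k + 1)) = (v (k + 1) - L (u (k + 1))) + t • d := by abel
  have h2 : -y (k + 1) = -y k + γ • (v (k + 1) - L (u (k + 1))) := by
    rw [h.y_step, neg_add, ← smul_neg, neg_sub]
  rw [h1, norm_add_sq_real, h2, norm_smul, mul_pow, Real.norm_eq_abs, sq_abs, inner_add_left,
    inner_add_left, real_inner_smul_left, real_inner_smul_left, real_inner_smul_right,
    inner_neg_left, real_inner_comm (y k) d]
  ring

end ADMM

end PartlySmooth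

open PartlySmooth
theorem proposition7p1 {n m : ℕ}
    (G : Eucl n → EReal) (J : Eucl m → EReal) (L : Eucl n →L[ℝ] Eucl m)
    (hG : IsGammaZero G) (hJ : IsGammaZero J) (hL : Function.Injective L)
    (hdom : (intrinsicInterior ℝ (effDomain G ∩ L ⁻¹' effDomain J)).Nonempty)
    (γ : ℝ) (hγ : 0 < γ)
    (u : ℕ → Eucl n) (v y : ℕ → Eucl m) (hADMM : IsADMM G J L γ u v y)
    (ustar : Eucl n) (vstar ystar : Eucl m)
    (hmin : IsMinOn (fun w => G w + J (L w)) univ ustar) (hLu : vstar = L ustar)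
    (hu : Tendsto u atTop (𝓝 ustar)) (hv : Tendsto v atTop (𝓝 vstar))
    (hy : Tendsto y atTop (𝓝 ystar))
    (MG : Set (Eucl n)) (MJ : Set (Eucl m))
    (hMG : IsPartlySmoothAt G ustar MG) (hMJ : IsPartlySmoothAt J vstar MJ)
    (hndG : -(ContinuousLinearMap.adjoint L ystar) ∈ intrinsicInterior ℝ (subdiff G ustar))
    (hndJ : ystar ∈ intrinsicInterior ℝ (subdiff J vstar)) :
    ∃ K : ℕ,
      (∀ k ≥ K, u k ∈ MG ∧ v k ∈ MJ) ∧
      (CoincidesNearWithAffine MG ustar (tangentOfSubdiff G ustar) →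
        ∀ k ≥ K, tangentOfSubdiff G (u k) = tangentOfSubdiff G ustar) ∧
      (CoincidesNearWithAffine MJ vstar (tangentOfSubdiff J vstar) →
        ∀ k ≥ K, tangentOfSubdiff J (v k) = tangentOfSubdiff J vstar) ∧
      (IsLocallyPolyhedral G ustar →
        CoincidesNearWithAffine MG ustar (tangentOfSubdiff G ustar) ∧
        ∃ gradG : Eucl n, HasRiemannianGradientAt MG G ustar gradG ∧
          ∀ k ≥ K, u k ∈ MG ∧ u k - ustar ∈ tangentOfSubdiff G ustar ∧
            tangentOfSubdiff G (u k) = tangentOfSubdiff G ustar ∧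
            HasRiemannianGradientAt MG G (u k) gradG ∧
            HasRiemannianHessianAt MG G (u k) 0) ∧
      (IsLocallyPolyhedral J vstar →
        CoincidesNearWithAffine MJ vstar (tangentOfSubdiff J vstar) ∧
        ∃ gradJ : Eucl m, HasRiemannianGradientAt MJ J vstar gradJ ∧
          ∀ k ≥ K, v k ∈ MJ ∧ v k - vstar ∈ tangentOfSubdiff J vstar ∧
            tangentOfSubdiff J (v k) = tangentOfSubdiff J vstar ∧
            HasRiemannianGradientAt MJ J (v k) gradJ ∧
            HasRiemannianHessianAt MJ J (v k) 0) := by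
  -- Indices are shifted to match `u k`; the truncated value at `k = 0` is never used as a
  -- subgradient.
  have hgG : Tendsto (fun k => -(ContinuousLinearMap.adjoint L
      (y (k - 1) + γ • (L (u k) - v (k - 1))))) atTop
      (𝓝 (-(ContinuousLinearMap.adjoint L ystar))) := by
    have hpred : Tendsto (fun k : ℕ => k - 1) atTop atTop := tendsto_sub_atTop_nat 1
    have hLu' : Tendsto (fun k => L (u k)) atTop (𝓝 vstar) :=
      hLu ▸ (L.continuous.tendsto ustar).comp hu
    have h1 := (hy.comp hpred).add ((hLu'.sub (hv.comp hpred)).const_smul γ)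
    rw [sub_self, smul_zero, add_zero] at h1
    exact (((ContinuousLinearMap.adjoint L).continuous.tendsto ystar).comp h1).neg
  have huM := hMG.eventually_mem_of_tendsto hndG hu hgG <| by
    filter_upwards [eventually_ge_atTop 1] with k hk
    obtain ⟨j, rfl⟩ := Nat.exists_eq_add_of_le' hk
    exact hADMM.neg_adjoint_mem_subdiff hG j
  have hvM := hMJ.eventually_mem_of_tendsto hndJ hv hy <| by
    filter_upwards [eventually_ge_atTop 1] with k hk
    obtain ⟨j, rfl⟩ := Nat.exists_eq_add_of_le' hk
    exact hADMM.mem_subdiff hJ j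
  -- Moving the hypothesis inside the eventual statement lets one `K` serve all the conditional
  -- conclusions.
  have hGaff := eventually_imp_distrib_left.2 fun h =>
    huM.eventually (hMG.eventually_tangentOfSubdiff_eq hndG h)
  have hJaff := eventually_imp_distrib_left.2 fun h =>
    hvM.eventually (hMJ.eventually_tangentOfSubdiff_eq hndJ h)
  have hGpoly := eventually_imp_distrib_left.2 fun h =>
    huM.eventually (hMG.eventually_of_isLocallyPolyhedral h hndG)
  have hJpoly := eventually_imp_distrib_left.2 fun h =>
    hvM.eventually (hMJ.eventually_of_isLocallyPolyhedral h hndJ)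
  obtain ⟨K, hK⟩ := eventually_atTop.1 ((huM.eventually self_mem_nhdsWithin).and <|
    (hvM.eventually self_mem_nhdsWithin).and <| hGaff.and <| hJaff.and <| hGpoly.and hJpoly)
  refine ⟨K, fun k hk => ⟨(hK k hk).1, (hK k hk).2.1⟩, fun h k hk => (hK k hk).2.2.1 h,
    fun h k hk => (hK k hk).2.2.2.1 h, fun h => ?_, fun h => ?_⟩
  · exact ⟨hMG.coincidesNearWithAffine h hndG, _,
      (hMG.eventually_hasRiemannianGradientAt h hndG).self_of_nhdsWithin hMG.mem,
      fun k hk => (hK k hk).2.2.2.2.1 h⟩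
  · exact ⟨hMJ.coincidesNearWithAffine h hndJ, _,
      (hMJ.eventually_hasRiemannianGradientAt h hndJ).self_of_nhdsWithin hMJ.mem,
      fun k hk => (hK k hk).2.2.2.2.2 h⟩
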